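/- Let $n\ge 0$ and identify $\mathfrak{gl}(n,\mathbb C)^*\simeq\mathfrak{gl}(n,\mathbb C)$ by the trace form and, by right-invariant forms, $T^*GL(n,\mathbb C)\simeq GL(n,\mathbb C)\times\mathfrak{gl}(n,\mathbb C)$. At $(g,B)$ the canonical symplectic form is $$\omega\bigl((\rho,b),(\hat\rho,\hat b)\bigr)=\operatorname{tr}\bigl(\rho\hat b-\hat\rho b-B[\rho,\hat\rho]\bigr),$$ where $(\rho,b)$ stands for the tangent vector $(\rho g,b)$. Hamiltonian vector fields are defined by $\omega(X_F,\cdot)=dF$ and $\{F,K\}=\omega(X_F,X_K)$. The left and right actions of $GL(n,\mathbb C)$ are $h\cdot_L(g,B)=(hg,hBh^{-1})$ and $h\cdot_R(g,B)=(gh^{-1},B)$, and the moment map of the left action is $\mu(g,B)=B$. On $\mathfrak{gl}(n,\mathbb C)^*$ take the Lie–Poisson bracket $\{f,k\}(B)=\operatorname{tr}\bigl(B[\nabla f(B),\nabla k(B)]\bigr)$, $\nabla$ being the gradient for the trace form. For $1\le i\le m\le n$ let $B_{(m)}$ be the upper-left $m\times m$ block of $B$, and regard $(B_{(m)})^{i-1}\in\mathfrak{gl}(m,\mathbb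 C)$ as an element of $\mathfrak{gl}(n,\mathbb C)$ (upper-left block, zero elsewhere). (1) There is a unique action of the additive group $A=\mathbb C^{n(n+1)/2}$ (coordinates indexed by $1\le i\le m\le n$) on $T^*GL(n,\mathbb C)$ whose one-parameter group of index $(m,i)$ is $z\cdot p=e^{z(\mu(p)_{(m)})^{i-1}}\cdot_L p$. There is a unique action of $\mathbb C^{n(n-1)/2}$ (coordinates indexed by $1\le i\le m\le n-1$) on $\mathfrak{gl}(n,\mathbb C)$, the classical Gelfand–Zeitlin action, whose one-parameter group of index $(m,i)$ is $z\cdot B=\operatorname{Ad}\bigl(e^{z(B_{(m)})^{i-1}}\bigr)B$. With time rescaled by the factor $i$ (that is, with $z$ replaced by $iz$), these one-parameter groups satisfy Hamilton's equations for the functions $\operatorname{tr}(\mu(p)_{(m)})^i$ on $T^*GL(n,\mathbb C)$ and $\operatorname{tr}(B_{(m)})^i$ on $\mathfrak{gl}(n,\mathbb C)^*$, respectively. (2) The right action preserves the Poisson bracket of $T^*GL(n,\mathbb C)$, and $\mu$ identifies its Poisson quotient with $\mathfrak{gl}(n,\mathbb C)^*$: $\mu$ induces a homeomorphism of the orbit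 space of the right action onto $\mathfrak{gl}(n,\mathbb C)$; a function $f$ is complex differentiable at $\mu(p)$ if and only if $f\circ\mu$ is so at $p$; and $\{f\circ\mu,k\circ\mu\}(p)=\{f,k\}(\mu(p))$ whenever $f,k$ are complex differentiable at $\mu(p)$. (3) The action of $A$ on $T^*GL(n,\mathbb C)$ commutes with the right action of $GL(n,\mathbb C)$, hence descends to an action of $A$ on this Poisson quotient. Under the identification in (2), $a\in A$ acts there as the classical Gelfand–Zeitlin action of the image of $a$ under the projection $\mathbb C^{n(n+1)/2}\to\mathbb C^{n(n-1)/2}$ forgetting the coordinates with $m=n$ (so these coordinates act trivially). -/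

import Mathlib

noncomputable section

namespace GelfandZeitlin

/-! ## Matrices, minors, exponentials -/

/-- The Lie algebra `gl(n, ℂ)`, identified throughout with its dual `gl(n, ℂ)*` by the trace form
`B ↦ (ξ ↦ tr (B ξ))`. -/
abbrev gl (n : ℕ) : Type := Matrix (Fin n) (Fin n) ℂ

/-- The cotangent bundle `T*GL(n, ℂ)`, trivialised by right-invariant forms: the pair `(g, B)` is
the covector at `g` sending a tangent vector `v ∈ T_g GL(n, ℂ) = gl(n, ℂ)` to `tr (B v g⁻¹)`. -/
abbrev CotangentGL (n : ℕ) : Type := GL (Fin n) ℂ × gl n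

/-- The upper-left `m × m` minor (submatrix) `B_(m)` of `B`. -/
def minor {n m : ℕ} (hm : m ≤ n) (B : gl n) : gl m :=
  B.submatrix (Fin.castLE hm) (Fin.castLE hm)

/-- The inclusion `gl(m, ℂ) ⊆ gl(n, ℂ)` as upper-left block, all other entries being `0`. -/
def pad {n m : ℕ} (C : gl m) : gl n :=
  fun a b => if h : a.1 < m ∧ b.1 < m then C ⟨a.1, h.1⟩ ⟨b.1, h.2⟩ else 0

/-- The exponential map `gl(n, ℂ) → GL(n, ℂ)`. -/
def expGL {n : ℕ} (X : gl n) : GL (Fin n) ℂ where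
  val := NormedSpace.exp X
  inv := NormedSpace.exp (-X)
  val_inv := by
    rw [← Matrix.exp_add_of_commute X (-X) (Commute.refl X).neg_right, add_neg_cancel,
      NormedSpace.exp_zero]
  inv_val := by
    rw [← Matrix.exp_add_of_commute (-X) X (Commute.refl X).neg_left, neg_add_cancel,
      NormedSpace.exp_zero]

/-- The adjoint action `Ad(h) B = h B h⁻¹`. -/
def Ad {n : ℕ} (h : GL (Fin n) ℂ) (B : gl n) : gl n := h.val * B * (h⁻¹).val

/-! ## The left and right actions on `T*GL(n, ℂ)` -/

/-- The left action `h · (g, B) = (h g, Ad(h) B)`. -/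
def leftAct {n : ℕ} (h : GL (Fin n) ℂ) (p : CotangentGL n) : CotangentGL n :=
  (h * p.1, Ad h p.2)

/-- The right action `h · (g, B) = (g h⁻¹, B)`. -/
def rightAct {n : ℕ} (h : GL (Fin n) ℂ) (p : CotangentGL n) : CotangentGL n :=
  (p.1 * h⁻¹, p.2)

/-- The moment map of the left action. -/
def momentLeft {n : ℕ} (p : CotangentGL n) : gl n := p.2

/-- Two covectors are equivalent if they lie in the same orbit of the right action. -/
def rightOrbitSetoid (n : ℕ) : Setoid (CotangentGL n) where
  r p q := ∃ h : GL (Fin n) ℂ, rightAct h p = q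
  iseqv :=
    { refl := fun p => ⟨1, by simp [rightAct]⟩
      symm := by
        rintro p q ⟨h, rfl⟩
        exact ⟨h⁻¹, by simp [rightAct]⟩
      trans := by
        rintro p q r ⟨h, rfl⟩ ⟨k, rfl⟩
        exact ⟨k * h, by simp [rightAct, mul_assoc]⟩ }

/-- The orbit space of `T*GL(n, ℂ)` under the right action, with the quotient topology. -/
abbrev RightQuotient (n : ℕ) : Type := Quotient (rightOrbitSetoid n)

/-- The projection of `T*GL(n, ℂ)` onto the orbit space of the right action. -/
def toQuotient {n : ℕ} (p : CotangentGL n) : RightQuotient n := Quotient.mk (rightOrbitSetoid n) p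

/-! ## The symplectic structure of `T*GL(n, ℂ)`

A tangent vector at `(g, B)` is written as a pair `(ρ, b)` of matrices, standing for the velocity
`(ρ g, b)`: `ρ` is a right-invariant vector field on the group, `b` a translation-invariant one on
`gl(n, ℂ)`. -/

/-- The canonical symplectic form at `(g, B)`:
`ω ((ρ, b), (ρ', b')) = tr (ρ b' - ρ' b - B [ρ, ρ'])`. -/
def omega {n : ℕ} (p : CotangentGL n) : LinearMap.BilinForm ℂ (gl n × gl n) :=
  LinearMap.mk₂ ℂ
    (fun x y => Matrix.trace (x.1 * y.2 - y.1 * x.2 - p.2 * (x.1 * y.1 - y.1 * x.1)))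
    (by
      intro x x' y
      rw [← Matrix.trace_add]
      congr 1
      simp only [Prod.fst_add, Prod.snd_add]
      noncomm_ring)
    (by
      intro c x y
      rw [← Matrix.trace_smul]
      congr 1
      simp only [Prod.smul_fst, Prod.smul_snd, smul_sub, Matrix.smul_mul, Matrix.mul_smul,
        mul_sub])
    (by
      intro x y y'
      rw [← Matrix.trace_add]
      congr 1
      simp only [Prod.fst_add, Prod.snd_add]
      noncomm_ring)
    (by
      intro c x y
      rw [← Matrix.trace_smul]
      congr 1
      simp only [Prod.smul_fst, Prod.smul_snd, smul_sub, Matrix.smul_mul, Matrix.mul_smul,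
        mul_sub])

theorem omega_apply {n : ℕ} (p : CotangentGL n) (x y : gl n × gl n) :
    omega p x y = Matrix.trace (x.1 * y.2 - y.1 * x.2 - p.2 * (x.1 * y.1 - y.1 * x.1)) := rfl

theorem omega_isAlt {n : ℕ} (p : CotangentGL n) : (omega p).IsAlt := by
  intro x
  simp [omega_apply]

theorem omega_nondegenerate {n : ℕ} (p : CotangentGL n) : (omega p).Nondegenerate := by
  have key : ∀ x : gl n × gl n, (∀ y, omega p x y = 0) → x = 0 := by
    rintro ⟨r, b⟩ h
    have hr : r = 0 := by
      apply Matrix.ext_iff_trace_mul_right.mpr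
      intro c
      simpa [omega_apply] using h (0, c)
    subst hr
    have hb : b = 0 := by
      apply Matrix.ext_iff_trace_mul_left.mpr
      intro c
      simpa [omega_apply] using h (c, 0)
    rw [hb]
    rfl
  refine ⟨key, fun x h => key x fun y => ?_⟩
  rw [← (omega_isAlt p).neg_eq, h y, neg_zero]

open Classical in
/-- A function on `T*GL(n, ℂ)`, viewed as a function on the open subset
`GL(n, ℂ) × gl(n, ℂ)` of `gl(n, ℂ) × gl(n, ℂ)` and extended by `0`. Since the subset is open, the
extension does not affect differentiability and derivatives at its points. -/
def extend {n : ℕ} (F : CotangentGL n → ℂ) (x : gl n × gl n) : ℂ :=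
  if h : IsUnit x.1 then F (h.unit, x.2) else 0

/-- Complex differentiability at `p` of a function on the complex manifold `T*GL(n, ℂ)`. -/
def HolAt {n : ℕ} (F : CotangentGL n → ℂ) (p : CotangentGL n) : Prop :=
  DifferentiableAt ℂ (extend F) (p.1.val, p.2)

/-- The differential of `F` at `p = (g, B)`, as a linear form in `(ρ, b)`: the derivative of `F` in
the direction `(ρ g, b)`. -/
def differential {n : ℕ} (F : CotangentGL n → ℂ) (p : CotangentGL n) :
    Module.Dual ℂ (gl n × gl n) :=
  (fderiv ℂ (extend F) (p.1.val, p.2)).toLinearMap ∘ₗ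
    LinearMap.prodMap (LinearMap.mulRight ℂ p.1.val) LinearMap.id

/-- The value at `p` of the Hamiltonian vector field `X_F`, characterised by
`ω (X_F, ·) = dF`. -/
def hamVec {n : ℕ} (F : CotangentGL n → ℂ) (p : CotangentGL n) : gl n × gl n :=
  ((omega p).toDual (omega_nondegenerate p)).symm (differential F p)

/-- The Poisson bracket `{F, K} = ω (X_F, X_K)` on `T*GL(n, ℂ)`. -/
def poisson {n : ℕ} (F K : CotangentGL n → ℂ) (p : CotangentGL n) : ℂ :=
  omega p (hamVec F p) (hamVec K p)

/-! ## The Lie-Poisson structure of `gl(n, ℂ)* ≃ gl(n, ℂ)` -/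

/-- The gradient of `f` with respect to the trace form: `df_B (b) = tr (∇f(B) b)`. -/
def grad {n : ℕ} (f : gl n → ℂ) (B : gl n) : gl n :=
  Matrix.of fun j k => fderiv ℂ f B (Matrix.single k j 1)

/-- The standard (Lie-Poisson) bracket `{f, k}(B) = tr (B [∇f(B), ∇k(B)])`. -/
def liePoisson {n : ℕ} (f k : gl n → ℂ) (B : gl n) : ℂ :=
  Matrix.trace (B * (grad f B * grad k B - grad k B * grad f B))

/-! ## Gelfand-Zeitlin actions -/

/-- The pairs `(m, i)` with `1 ≤ i ≤ m ≤ n`. -/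
abbrev GZIndex (n : ℕ) : Type := {q : ℕ × ℕ // 1 ≤ q.2 ∧ q.2 ≤ q.1 ∧ q.1 ≤ n}

/-- The pairs `(m, i)` with `1 ≤ i ≤ m ≤ n - 1`. -/
abbrev GZIndexClassical (n : ℕ) : Type := {q : ℕ × ℕ // 1 ≤ q.2 ∧ q.2 ≤ q.1 ∧ q.1 < n}

/-- The inclusion of index sets. -/
def GZIndexClassical.incl {n : ℕ} (q : GZIndexClassical n) : GZIndex n :=
  ⟨q.1, q.2.1, q.2.2.1, q.2.2.2.le⟩

/-- The abelian group `A ≃ ℂ^{n(n+1)/2}`. -/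
abbrev GZGroup (n : ℕ) : Type := GZIndex n → ℂ

/-- The abelian group `ℂ^{n(n-1)/2}` acting on `gl(n, ℂ)`. -/
abbrev GZGroupClassical (n : ℕ) : Type := GZIndexClassical n → ℂ

/-- The projection `ℂ^{n(n+1)/2} → ℂ^{n(n-1)/2}` forgetting the coordinates with `m = n`. -/
def GZGroup.restrict {n : ℕ} (a : GZGroup n) : GZGroupClassical n := fun q => a q.incl

/-- The matrix `(B_(m))^{i-1}`, viewed in `gl(n, ℂ)`. -/
def gzElement {n : ℕ} (q : GZIndex n) (B : gl n) : gl n :=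
  pad (minor q.2.2.2 B ^ (q.1.2 - 1))

/-- The Gelfand-Zeitlin function `p_{mi}(B) = tr (B_(m))^i`. -/
def gzFun {n : ℕ} (q : GZIndex n) (B : gl n) : ℂ :=
  Matrix.trace (minor q.2.2.2 B ^ q.1.2)

/-- `Φ` is an action of the additive group `A` on `M`. -/
structure IsAction {A M : Type} [AddGroup A] (Φ : A → M → M) : Prop where
  zero : ∀ p, Φ 0 p = p
  add : ∀ a b p, Φ (a + b) p = Φ a (Φ b p)

/-- `Φ` is the action of `A` on `T*GL(n, ℂ)` induced by the left action of `GL(n, ℂ)`: the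
one-parameter group of index `(m, i)` is `z · p = exp (z (μ(p)_(m))^{i-1}) · p`, where `μ` is the
moment map of the left action. -/
structure IsGZActionCotangent {n : ℕ} (Φ : GZGroup n → CotangentGL n → CotangentGL n) : Prop where
  isAction : IsAction Φ
  single : ∀ (q : GZIndex n) (z : ℂ) (p : CotangentGL n),
    Φ (Pi.single q z) p = leftAct (expGL (z • gzElement q (momentLeft p))) p

/-- `Ψ` is the classical Gelfand-Zeitlin action: the one-parameter group of index `(m, i)`, `m < n`,
is `z · B = Ad (exp (z (B_(m))^{i-1})) B`. -/
structure IsGZActionClassical {n : ℕ} (Ψ : GZGroupClassical n → gl n → gl n) : Prop where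
  isAction : IsAction Ψ
  single : ∀ (q : GZIndexClassical n) (z : ℂ) (B : gl n),
    Ψ (Pi.single q z) B = Ad (expGL (z • gzElement q.incl B)) B

end GelfandZeitlin

end

open GelfandZeitlin

/-!
Everything rests on one fact about a flow `B ↦ Ad (exp (z ξ(B))) B` with generator
`ξ(B) = (B_(m))^{i-1}`. Writing `P` for the idempotent of the upper-left `m × m` block, the
generator is `P (P B P)^{i-1}` (`gzElement_eq`), so minors become products in `gl n`. The generator
commutes with its own block `P B P`, hence its flow changes neither that block nor any smaller one
(`gzElement_Ad_gzExp_of_le`); and its exponential commutes with the idempotent of every larger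
block, hence conjugates the generators belonging to larger blocks (`gzElement_Ad`). These two
observations make each flow a one-parameter group and make any two flows commute, at the level of
the group elements themselves (`gzExp_add`, `gzExp_comm`). They therefore hold on `T*GL(n, ℂ)` and
on `gl(n, ℂ)` alike, and pairwise commuting one-parameter groups generate a unique action
(`existsUnique_action_of_commuting_flows`).

For Hamilton's equations, the Hamiltonian vector field of `f ∘ μ` at `(g, B)` is
`(∇f(B), [∇f(B), B])`, the infinitesimal left action of `∇f(B)` (`hamVec_comp_momentLeft`). The
gradient of `tr (B_(m))^i` is `i (B_(m))^{i-1}` (`grad_gzFun`), which is constant along the flow, so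
the flow is the exponential curve with that velocity. The same formula for the vector field gives
the identification of the Poisson brackets. Right translations do not affect the right-invariant
coordinates `(ρ, b)` of tangent vectors, so they preserve the bracket, and the orbit map of the
right action has the continuous section `B ↦ (1, B)`. Finally the moment map intertwines the
one-parameter groups, hence the actions (`momentLeft_action`).

Derivatives are stated for the topology of the space of matrices. Where a rule of calculus requires
a norm, the operator norm is used inside the proof; it induces the same topology.
-/

namespace GelfandZeitlin

/-! ### Actions generated by commuting one-parameter groups -/

/-- Two actions of a finite power of `ℂ` agree, along an equivariant map, as soon as they agree on
the coordinate one-parameter groups. -/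
theorem IsAction.semiconj {ι κ : Type} [Finite ι] [DecidableEq ι] {M N : Type}
    {Φ : (ι → ℂ) → M → M} {Ψ : (κ → ℂ) → N → N} (hΦ : IsAction Φ) (hΨ : IsAction Ψ)
    (r : (ι → ℂ) →+ (κ → ℂ)) (μ : M → N)
    (h : ∀ q z p, μ (Φ (Pi.single q z) p) = Ψ (r (Pi.single q z)) (μ p)) (a : ι → ℂ) (p : M) :
    μ (Φ a p) = Ψ (r a) (μ p) := by
  cases nonempty_fintype ι
  revert p
  refine Pi.single_induction (fun a => ∀ p, μ (Φ a p) = Ψ (r a) (μ p)) a ?_ ?_ h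
  · intro p
    rw [map_zero, hΦ.zero, hΨ.zero]
  · intro a b ha hb p
    rw [map_add, hΦ.add, hΨ.add, ha, hb]

/-- Pairwise commuting one-parameter groups of transformations generate a unique action of the
product of the parameter groups. -/
theorem existsUnique_action_of_commuting_flows {ι M : Type} [Finite ι] [DecidableEq ι]
    (φ : ι → ℂ → M → M) (zero : ∀ q p, φ q 0 p = p)
    (add : ∀ q z w p, φ q (z + w) p = φ q z (φ q w p))
    (comm : ∀ q q' z w p, φ q z (φ q' w p) = φ q' w (φ q z p)) :
    ∃! Φ : (ι → ℂ) → M → M, IsAction Φ ∧ ∀ q z p, Φ (Pi.single q z) p = φ q z p := by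
  cases nonempty_fintype ι
  -- The flows, as homomorphisms into the monoid of self-maps of `M` under composition.
  let ϕ (q : ι) : ℂ →+ Additive (Function.End M) :=
    { toFun := fun z => Additive.ofMul (φ q z : Function.End M)
      map_zero' := congrArg Additive.ofMul (funext fun p => zero q p)
      map_add' := fun z w => congrArg Additive.ofMul (funext fun p => add q z w p) }
  have hϕ : Pairwise fun q q' => ∀ z w, AddCommute (ϕ q z) (ϕ q' w) := fun q q' _ z w =>
    congrArg Additive.ofMul (funext fun p => comm q q' z w p)
  let T := AddMonoidHom.noncommPiCoprod ϕ hϕ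
  have hT : IsAction fun (a : ι → ℂ) (p : M) => (T a).toMul p :=
    ⟨fun p => congrFun (congrArg Additive.toMul (map_zero T)) p,
      fun a b p => congrFun (congrArg Additive.toMul (map_add T a b)) p⟩
  have hs : ∀ q z p, (T (Pi.single q z)).toMul p = φ q z p := fun q z p =>
    congrFun (congrArg Additive.toMul (AddMonoidHom.noncommPiCoprod_single ϕ (hcomm := hϕ) q z)) p
  refine ⟨_, ⟨hT, hs⟩, ?_⟩
  rintro Φ ⟨hΦ, hΦs⟩
  funext a p
  exact hΦ.semiconj hT (AddMonoidHom.id _) id (fun q z p => (hΦs q z p).trans (hs q z p).symm) a p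

/-! ### Upper-left blocks and their exponentials -/

/-- The idempotent projecting onto the span of the first `m` basis vectors. -/
def blockProj (n m : ℕ) : gl n := pad (1 : gl m)

theorem blockProj_apply {n m : ℕ} (a b : Fin n) :
    blockProj n m a b = if a = b ∧ a.1 < m then 1 else 0 := by
  unfold blockProj pad
  split_ifs with h h' h' <;> simp_all [Matrix.one_apply, Fin.ext_iff]
  omega

theorem blockProj_eq_diagonal (n m : ℕ) :
    blockProj n m = Matrix.diagonal fun a => if a.1 < m then (1 : ℂ) else 0 := by
  ext a b
  rw [blockProj_apply, Matrix.diagonal_apply, ite_and]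

theorem blockProj_mul_of_le {n m m' : ℕ} (h : m ≤ m') :
    blockProj n m' * blockProj n m = blockProj n m := by
  simp only [blockProj_eq_diagonal, Matrix.diagonal_mul_diagonal]
  congr 1
  ext a
  split_ifs <;> first | omega | simp

theorem mul_blockProj_of_le {n m m' : ℕ} (h : m ≤ m') :
    blockProj n m * blockProj n m' = blockProj n m := by
  simp only [blockProj_eq_diagonal, Matrix.diagonal_mul_diagonal]
  congr 1
  ext a
  split_ifs <;> first | omega | simp

theorem blockProj_self (n : ℕ) : blockProj n n = 1 := by
  ext a b
  simp [blockProj_apply, Matrix.one_apply]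

theorem pad_minor {n m : ℕ} (hm : m ≤ n) (B : gl n) :
    pad (minor hm B) = blockProj n m * B * blockProj n m := by
  ext a b
  simp only [blockProj_eq_diagonal, Matrix.mul_diagonal, Matrix.diagonal_mul, pad, minor]
  split_ifs <;> simp_all

theorem sum_castLE {n m : ℕ} (hm : m ≤ n) (f : Fin n → ℂ) (hf : ∀ a : Fin n, ¬ a.1 < m → f a = 0) :
    ∑ a, f a = ∑ a : Fin m, f (Fin.castLE hm a) := by
  symm
  apply Finset.sum_of_injOn (Fin.castLE hm)
  · exact (Fin.castLE_injective hm).injOn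
  · simp
  · intro a _ ha
    refine hf a fun h => ha ⟨⟨a.1, h⟩, by simp, rfl⟩
  · simp

theorem pad_mul {n m : ℕ} (hm : m ≤ n) (C D : gl m) : (pad (C * D) : gl n) = pad C * pad D := by
  ext a b
  rw [Matrix.mul_apply, sum_castLE hm _ (fun c hc => by simp [pad, hc])]
  by_cases ha : a.1 < m <;> by_cases hb : b.1 < m <;> simp [pad, ha, hb, Matrix.mul_apply]

theorem trace_pad_mul {n m : ℕ} (hm : m ≤ n) (C : gl m) (B : gl n) :
    Matrix.trace (pad C * B) = Matrix.trace (C * minor hm B) := by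
  simp only [Matrix.trace, Matrix.diag_apply, Matrix.mul_apply]
  rw [sum_castLE hm _ (fun a ha => by simp [pad, ha])]
  refine Finset.sum_congr rfl fun a _ => ?_
  rw [sum_castLE hm _ (fun c hc => by simp [pad, hc])]
  simp [pad, minor]

theorem pad_pow {n m : ℕ} (hm : m ≤ n) (C : gl m) (k : ℕ) :
    (pad (C ^ k) : gl n) = blockProj n m * pad C ^ k := by
  induction k with
  | zero => simp [blockProj]
  | succ k ih => rw [pow_succ, pad_mul hm, ih, pow_succ, mul_assoc]

/-- In terms of the idempotent `P` of the block, `gzElement` is `P (P B P) ^ (i - 1)`. -/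
theorem gzElement_eq {n : ℕ} (q : GZIndex n) (B : gl n) :
    gzElement q B =
      blockProj n q.1.1 * (blockProj n q.1.1 * B * blockProj n q.1.1) ^ (q.1.2 - 1) := by
  rw [gzElement, pad_pow q.2.2.2, pad_minor]

theorem blockProj_mul_gzElement {n : ℕ} (q : GZIndex n) {m : ℕ} (h : q.1.1 ≤ m) (B : gl n) :
    blockProj n m * gzElement q B = gzElement q B := by
  rw [gzElement_eq, ← mul_assoc, blockProj_mul_of_le h]

theorem commute_blockProj_conj (n m : ℕ) (B : gl n) :
    Commute (blockProj n m) (blockProj n m * B * blockProj n m) := by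
  have h := blockProj_mul_of_le (n := n) (le_refl m)
  rw [Commute, SemiconjBy, ← mul_assoc, ← mul_assoc, h, mul_assoc (_ * B), h]

theorem gzElement_mul_blockProj {n : ℕ} (q : GZIndex n) {m : ℕ} (h : q.1.1 ≤ m) (B : gl n) :
    gzElement q B * blockProj n m = gzElement q B := by
  rw [gzElement_eq, ((commute_blockProj_conj n q.1.1 B).pow_right _).eq, mul_assoc,
    mul_blockProj_of_le h]

theorem commute_gzElement_blockProj {n : ℕ} (q : GZIndex n) {m : ℕ} (h : q.1.1 ≤ m) (B : gl n) :
    Commute (gzElement q B) (blockProj n m) :=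
  (gzElement_mul_blockProj q h B).trans (blockProj_mul_gzElement q h B).symm

/-- The Gelfand-Zeitlin element commutes with its own block `P B P`. -/
theorem commute_gzElement_conj {n : ℕ} (q : GZIndex n) (B : gl n) :
    Commute (gzElement q B) (blockProj n q.1.1 * B * blockProj n q.1.1) := by
  rw [gzElement_eq]
  exact (commute_blockProj_conj n _ B).mul_left ((Commute.refl _).pow_left _)

/-- The group element by which the one-parameter group of index `q` moves `B` in time `z`. -/
noncomputable def gzExp {n : ℕ} (q : GZIndex n) (z : ℂ) (B : gl n) : GL (Fin n) ℂ :=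
  expGL (z • gzElement q B)

theorem commute_expGL {n : ℕ} {X Y : gl n} (h : Commute X Y) : Commute (expGL X).val Y :=
  open scoped Matrix.Norms.Operator in h.exp_left

theorem expGL_zero {n : ℕ} : expGL (0 : gl n) = 1 := Units.ext (NormedSpace.exp_zero)

theorem expGL_add {n : ℕ} {X Y : gl n} (h : Commute X Y) :
    expGL (X + Y) = expGL X * expGL Y :=
  Units.ext (Matrix.exp_add_of_commute X Y h)

theorem expGL_Ad {n : ℕ} (h : GL (Fin n) ℂ) (X : gl n) :
    expGL (Ad h X) = h * expGL X * h⁻¹ :=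
  Units.ext (Matrix.exp_units_conj h X)

theorem Ad_smul {n : ℕ} (h : GL (Fin n) ℂ) (z : ℂ) (X : gl n) : Ad h (z • X) = z • Ad h X := by
  simp [Ad]

theorem Ad_mul {n : ℕ} (h : GL (Fin n) ℂ) (X Y : gl n) : Ad h (X * Y) = Ad h X * Ad h Y := by
  simp [Ad, mul_assoc]

theorem Ad_pow {n : ℕ} (h : GL (Fin n) ℂ) (X : gl n) (k : ℕ) : Ad h (X ^ k) = Ad h X ^ k := by
  induction k with
  | zero => simp [Ad]
  | succ k ih => rw [pow_succ, Ad_mul, ih, pow_succ]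

theorem Ad_one {n : ℕ} (B : gl n) : Ad 1 B = B := by simp [Ad]

theorem Ad_Ad {n : ℕ} (g h : GL (Fin n) ℂ) (B : gl n) : Ad (g * h) B = Ad g (Ad h B) := by
  simp [Ad, mul_assoc]

theorem Ad_eq_self {n : ℕ} {h : GL (Fin n) ℂ} {X : gl n} (hX : Commute h.val X) :
    Ad h X = X := by
  rw [Ad, hX.eq, mul_assoc, Units.mul_inv, mul_one]

/-- Elements commuting with the idempotent of a block act on that block by conjugation. -/
theorem blockProj_Ad {n m : ℕ} {h : GL (Fin n) ℂ} (hh : Commute h.val (blockProj n m)) (B : gl n) :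
    blockProj n m * Ad h B * blockProj n m = Ad h (blockProj n m * B * blockProj n m) := by
  rw [Ad_mul, Ad_mul, Ad_eq_self hh]

/-- The Gelfand-Zeitlin elements are equivariant under the group elements that respect the
decomposition of `ℂⁿ` into the first `m` and the remaining coordinates. -/
theorem gzElement_Ad {n : ℕ} (q : GZIndex n) {h : GL (Fin n) ℂ}
    (hh : Commute h.val (blockProj n q.1.1)) (B : gl n) :
    gzElement q (Ad h B) = Ad h (gzElement q B) := by
  rw [gzElement_eq, blockProj_Ad hh, gzElement_eq, Ad_mul h (blockProj n q.1.1), Ad_pow,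
    Ad_eq_self hh]

theorem commute_gzExp_blockProj {n : ℕ} (q : GZIndex n) (z : ℂ) (B : gl n) {m : ℕ}
    (h : q.1.1 ≤ m) : Commute (gzExp q z B).val (blockProj n m) :=
  commute_expGL ((commute_gzElement_blockProj q h B).smul_left z)

/-- The flow of a larger block leaves the Gelfand-Zeitlin elements of all smaller blocks fixed: it
does not even change its own block. -/
theorem gzElement_Ad_gzExp_of_le {n : ℕ} {q q' : GZIndex n} (h : q.1.1 ≤ q'.1.1) (z : ℂ)
    (B : gl n) : gzElement q (Ad (gzExp q' z B) B) = gzElement q B := by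
  -- The block of `q'` commutes with the generator, a power of that block.
  have key : blockProj n q'.1.1 * Ad (gzExp q' z B) B * blockProj n q'.1.1 =
      blockProj n q'.1.1 * B * blockProj n q'.1.1 := by
    rw [blockProj_Ad (commute_gzExp_blockProj q' z B le_rfl)]
    exact Ad_eq_self (commute_expGL ((commute_gzElement_conj q' B).smul_left z))
  have small (X : gl n) : blockProj n q.1.1 * X * blockProj n q.1.1 =
      blockProj n q.1.1 * (blockProj n q'.1.1 * X * blockProj n q'.1.1) * blockProj n q.1.1 := by
    rw [← mul_assoc, ← mul_assoc, mul_blockProj_of_le h, mul_assoc _ (blockProj n q'.1.1),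
      blockProj_mul_of_le h]
  rw [gzElement_eq, gzElement_eq, small (Ad _ _), key, ← small]

theorem gzExp_zero {n : ℕ} (q : GZIndex n) (B : gl n) : gzExp q 0 B = 1 := by
  rw [gzExp, zero_smul, expGL_zero]

/-- The cocycle identity for a single flow; it reduces to the additivity of the exponential because
the generator is constant along the flow. -/
theorem gzExp_add {n : ℕ} (q : GZIndex n) (z w : ℂ) (B : gl n) :
    gzExp q (z + w) B = gzExp q z (Ad (gzExp q w B) B) * gzExp q w B := by
  rw [gzExp, gzExp, gzElement_Ad_gzExp_of_le le_rfl, add_smul,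
    expGL_add (((Commute.refl _).smul_left z).smul_right w), gzExp]

/-- For `m ≤ m'` both composites equal `exp (z ξ) exp (w ξ')`: the flow of the larger block fixes
`ξ`, whereas that of the smaller block conjugates `ξ'` by `exp (z ξ)`. -/
theorem gzExp_comm_of_le {n : ℕ} {q q' : GZIndex n} (h : q.1.1 ≤ q'.1.1) (z w : ℂ) (B : gl n) :
    gzExp q z (Ad (gzExp q' w B) B) * gzExp q' w B =
      gzExp q' w (Ad (gzExp q z B) B) * gzExp q z B := by
  have h₁ : gzExp q z (Ad (gzExp q' w B) B) = gzExp q z B := by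
    rw [gzExp, gzElement_Ad_gzExp_of_le h, gzExp]
  have h₂ : gzExp q' w (Ad (gzExp q z B) B) =
      gzExp q z B * gzExp q' w B * (gzExp q z B)⁻¹ := by
    rw [gzExp, gzElement_Ad q' (commute_gzExp_blockProj q z B h), ← Ad_smul, expGL_Ad]
    rfl
  rw [h₁, h₂, inv_mul_cancel_right]

/-- The cocycle identity saying that any two Gelfand-Zeitlin flows commute. -/
theorem gzExp_comm {n : ℕ} (q q' : GZIndex n) (z w : ℂ) (B : gl n) :
    gzExp q z (Ad (gzExp q' w B) B) * gzExp q' w B =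
      gzExp q' w (Ad (gzExp q z B) B) * gzExp q z B :=
  (le_total q.1.1 q'.1.1).elim (fun h => gzExp_comm_of_le h z w B)
    fun h => (gzExp_comm_of_le h w z B).symm

/-- The flows of the full block `m = n` fix every matrix. -/
theorem Ad_gzExp_of_eq {n : ℕ} {q : GZIndex n} (h : q.1.1 = n) (z : ℂ) (B : gl n) :
    Ad (gzExp q z B) B = B := by
  have := commute_gzElement_conj q B
  rw [h, blockProj_self, one_mul, mul_one] at this
  exact Ad_eq_self (commute_expGL (this.smul_left z))

/-! ### Existence and uniqueness of the Gelfand-Zeitlin actions -/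

theorem leftAct_mul {n : ℕ} (g h : GL (Fin n) ℂ) (p : CotangentGL n) :
    leftAct (g * h) p = leftAct g (leftAct h p) := by
  simp [leftAct, Ad_Ad, mul_assoc]

theorem leftAct_one {n : ℕ} (p : CotangentGL n) : leftAct 1 p = p := by
  simp [leftAct, Ad_one]

theorem leftAct_rightAct {n : ℕ} (g h : GL (Fin n) ℂ) (p : CotangentGL n) :
    leftAct g (rightAct h p) = rightAct h (leftAct g p) := by
  simp [leftAct, rightAct, mul_assoc]

instance finite_GZIndex (n : ℕ) : Finite (GZIndex n) :=
  ((Set.finite_Iic (n, n)).subset fun _ hq => ⟨hq.2.2, hq.2.1.trans hq.2.2⟩).to_subtype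

theorem GZIndexClassical.incl_injective {n : ℕ} :
    Function.Injective (GZIndexClassical.incl (n := n)) := fun q q' h => by
  simpa [GZIndexClassical.incl, Subtype.ext_iff] using h

instance finite_GZIndexClassical (n : ℕ) : Finite (GZIndexClassical n) :=
  Finite.of_injective _ GZIndexClassical.incl_injective

theorem existsUnique_isGZActionCotangent (n : ℕ) :
    ∃! Φ : GZGroup n → CotangentGL n → CotangentGL n, IsGZActionCotangent Φ := by
  convert! existsUnique_action_of_commuting_flows
    (fun (q : GZIndex n) z p => leftAct (gzExp q z p.2) p) ?_ ?_ ?_ using 2 with Φ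
  · exact ⟨fun h => ⟨h.1, h.2⟩, fun h => ⟨h.1, h.2⟩⟩
  · intro q p
    rw [gzExp_zero, leftAct_one]
  · intro q z w p
    rw [gzExp_add, leftAct_mul]
    rfl
  · intro q q' z w p
    rw [← leftAct_mul, ← leftAct_mul]
    exact congrArg (leftAct · p) (gzExp_comm q q' z w p.2)

theorem existsUnique_isGZActionClassical (n : ℕ) :
    ∃! Ψ : GZGroupClassical n → gl n → gl n, IsGZActionClassical Ψ := by
  convert! existsUnique_action_of_commuting_flows
    (fun (q : GZIndexClassical n) z B => Ad (gzExp q.incl z B) B) ?_ ?_ ?_ using 2 with Ψ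
  · exact ⟨fun h => ⟨h.1, h.2⟩, fun h => ⟨h.1, h.2⟩⟩
  · intro q B
    rw [gzExp_zero, Ad_one]
  · intro q z w B
    rw [gzExp_add, Ad_Ad]
  · intro q q' z w B
    rw [← Ad_Ad, ← Ad_Ad, gzExp_comm]

/-! ### Differentials, gradients and Hamiltonian vector fields -/

open Topology

theorem extend_apply {n : ℕ} (F : CotangentGL n → ℂ) (p : CotangentGL n) :
    extend F (p.1.val, p.2) = F p := by
  have h : IsUnit p.1.val := p.1.isUnit
  rw [extend, dif_pos h]
  congr
  exact Units.ext rfl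

theorem isOpen_isUnit_fst (n : ℕ) : IsOpen {x : gl n × gl n | IsUnit x.1} := by
  simp only [Matrix.isUnit_iff_isUnit_det, isUnit_iff_ne_zero]
  exact isOpen_ne_fun continuous_fst.matrix_det continuous_const

theorem extend_comp_momentLeft {n : ℕ} (f : gl n → ℂ) (p : CotangentGL n) :
    extend (fun x => f (momentLeft x)) =ᶠ[𝓝 (p.1.val, p.2)] fun x => f x.2 := by
  filter_upwards [(isOpen_isUnit_fst n).mem_nhds p.1.isUnit] with x hx
  rw [extend, dif_pos hx]
  rfl

theorem differential_apply {n : ℕ} (F : CotangentGL n → ℂ) (p : CotangentGL n) (ρ b : gl n) :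
    differential F p (ρ, b) = fderiv ℂ (extend F) (p.1.val, p.2) (ρ * p.1.val, b) := rfl

theorem poisson_eq_differential {n : ℕ} (F K : CotangentGL n → ℂ) (p : CotangentGL n) :
    poisson F K p = differential F p (hamVec K p) :=
  LinearMap.BilinForm.apply_toDual_symm_apply (hB := omega_nondegenerate p) _ _

/-- The gradient represents the derivative by the trace form. -/
theorem trace_grad_mul {n : ℕ} (f : gl n → ℂ) (B b : gl n) :
    Matrix.trace (grad f B * b) = fderiv ℂ f B b := by
  conv_rhs => rw [Matrix.matrix_eq_sum_single b]
  simp only [map_sum, Matrix.trace, Matrix.diag_apply, Matrix.mul_apply, grad, Matrix.of_apply]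
  rw [Finset.sum_comm]
  refine Finset.sum_congr rfl fun k _ => Finset.sum_congr rfl fun j _ => ?_
  have : Matrix.single k j (b k j) = b k j • (Matrix.single k j 1 : gl n) := by simp
  rw [this, map_smul, smul_eq_mul, mul_comm]

theorem liePoisson_eq_fderiv {n : ℕ} (f k : gl n → ℂ) (B : gl n) :
    liePoisson f k B = fderiv ℂ f B (grad k B * B - B * grad k B) := by
  rw [← trace_grad_mul, liePoisson, mul_sub, mul_sub, Matrix.trace_sub, Matrix.trace_sub,
    ← mul_assoc (grad f B), Matrix.trace_mul_comm B, ← mul_assoc B, Matrix.trace_mul_comm (B * _)]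

/-- Differentiability descends along the moment map because `B ↦ (g, B)` is a holomorphic section
through any given point. -/
theorem holAt_comp_momentLeft_iff {n : ℕ} (f : gl n → ℂ) (p : CotangentGL n) :
    HolAt (fun x => f (momentLeft x)) p ↔ DifferentiableAt ℂ f p.2 := by
  rw [HolAt, (extend_comp_momentLeft f p).differentiableAt_iff]
  open scoped Matrix.Norms.Operator in
  constructor
  · intro h
    have : DifferentiableAt ℂ (fun b : gl n => (p.1.val, b)) p.2 := by fun_prop
    exact DifferentiableAt.comp p.2 (g := fun x : gl n × gl n => f x.2) h this
  · intro h
    exact DifferentiableAt.comp (p.1.val, p.2) (g := f) h differentiableAt_snd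

theorem differential_comp_momentLeft {n : ℕ} {f : gl n → ℂ} {p : CotangentGL n}
    (hf : DifferentiableAt ℂ f p.2) (ρ b : gl n) :
    differential (fun x => f (momentLeft x)) p (ρ, b) = fderiv ℂ f p.2 b := by
  rw [differential_apply, (extend_comp_momentLeft f p).fderiv_eq]
  open scoped Matrix.Norms.Operator in
  have h := HasFDerivAt.comp (p.1.val, p.2) (g := f) (f := Prod.snd) hf.hasFDerivAt
    (hasFDerivAt_snd (𝕜 := ℂ))
  exact congrArg (fun L : gl n × gl n →L[ℂ] ℂ => L (ρ * p.1.val, b)) h.fderiv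

/-- The Hamiltonian vector field of `f ∘ μ` generates the left action of `∇f(μ(p))`. -/
theorem hamVec_comp_momentLeft {n : ℕ} {f : gl n → ℂ} {p : CotangentGL n}
    (hf : DifferentiableAt ℂ f p.2) :
    hamVec (fun x => f (momentLeft x)) p =
      (grad f p.2, grad f p.2 * p.2 - p.2 * grad f p.2) := by
  rw [hamVec, LinearEquiv.symm_apply_eq]
  refine LinearMap.ext fun ⟨ρ, b⟩ => ?_
  rw [differential_comp_momentLeft hf, LinearMap.BilinForm.toDual_def, omega_apply,
    ← trace_grad_mul]
  have h₁ : Matrix.trace (ρ * (grad f p.2 * p.2)) = Matrix.trace (p.2 * (ρ * grad f p.2)) := by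
    rw [← mul_assoc, Matrix.trace_mul_comm]
  have h₂ : Matrix.trace (ρ * (p.2 * grad f p.2)) = Matrix.trace (p.2 * (grad f p.2 * ρ)) := by
    rw [Matrix.trace_mul_comm, mul_assoc]
  simp only [Matrix.trace_sub, mul_sub]
  rw [h₁, h₂]
  ring

/-- A coordinate-free form of Hamilton's equations for functions of the moment map. -/
theorem poisson_comp_momentLeft {n : ℕ} (F : CotangentGL n → ℂ) {k : gl n → ℂ} {p : CotangentGL n}
    (hk : DifferentiableAt ℂ k p.2) :
    poisson F (fun x => k (momentLeft x)) p =
      differential F p (grad k p.2, grad k p.2 * p.2 - p.2 * grad k p.2) := by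
  rw [poisson_eq_differential, hamVec_comp_momentLeft hk]

theorem poisson_comp_momentLeft_eq_liePoisson {n : ℕ} {f k : gl n → ℂ} {p : CotangentGL n}
    (hf : DifferentiableAt ℂ f p.2) (hk : DifferentiableAt ℂ k p.2) :
    poisson (fun x => f (momentLeft x)) (fun x => k (momentLeft x)) p = liePoisson f k p.2 := by
  rw [poisson_comp_momentLeft _ hk, differential_comp_momentLeft hf, liePoisson_eq_fderiv]

/-- Right translation by `h` does not change the coordinates of tangent vectors in the
right-invariant trivialisation. -/
theorem differential_comp_rightAct {n : ℕ} (h : GL (Fin n) ℂ) {F : CotangentGL n → ℂ}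
    {p : CotangentGL n} (hF : HolAt F (rightAct h p)) :
    differential (fun x => F (rightAct h x)) p = differential F (rightAct h p) := by
  let T : gl n × gl n →L[ℂ] gl n × gl n := LinearMap.toContinuousLinearMap
    ((LinearMap.mulRight ℂ (h⁻¹).val).prodMap LinearMap.id)
  have hext : extend (fun x => F (rightAct h x)) = extend F ∘ T := by
    funext x
    have hT : T x = (x.1 * (h⁻¹).val, x.2) := rfl
    by_cases hx : IsUnit x.1
    · obtain ⟨g, hg⟩ := hx
      have hx : x = (g.val, x.2) := Prod.ext hg.symm rfl
      have e := extend_apply F (rightAct h (g, x.2))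
      rw [Function.comp_apply, hT, ← hg]
      conv_lhs => rw [hx]
      exact (extend_apply (fun x => F (rightAct h x)) (g, x.2)).trans e.symm
    · have hx' : ¬ IsUnit (x.1 * (h⁻¹).val) := by rwa [Units.isUnit_mul_units]
      rw [Function.comp_apply, hT, extend, extend, dif_neg hx, dif_neg hx']
  refine LinearMap.ext fun ⟨ρ, b⟩ => ?_
  rw [differential_apply, differential_apply, hext]
  open scoped Matrix.Norms.Operator in
  have hd := HasFDerivAt.comp (p.1.val, p.2) (g := extend F) (f := T)
    (DifferentiableAt.hasFDerivAt hF) T.hasFDerivAt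
  refine (congrArg (fun L : gl n × gl n →L[ℂ] ℂ => L (ρ * p.1.val, b)) hd.fderiv).trans ?_
  have : T (ρ * p.1.val, b) = (ρ * (rightAct h p).1.val, b) :=
    Prod.ext (mul_assoc _ _ _) rfl
  exact congrArg (fderiv ℂ (extend F) (T (p.1.val, p.2))) this

theorem poisson_comp_rightAct {n : ℕ} (h : GL (Fin n) ℂ) {F K : CotangentGL n → ℂ}
    {p : CotangentGL n} (hF : HolAt F (rightAct h p)) (hK : HolAt K (rightAct h p)) :
    poisson (fun x => F (rightAct h x)) (fun x => K (rightAct h x)) p =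
      poisson F K (rightAct h p) := by
  rw [poisson, hamVec, hamVec, differential_comp_rightAct h hF, differential_comp_rightAct h hK]
  rfl

/-! ### Hamilton's equations -/

/-- The derivative of `x ↦ x ^ k` in a noncommutative normed algebra. -/
theorem exists_hasFDerivAt_pow {A : Type*} [NormedRing A] [NormedAlgebra ℂ A] (k : ℕ) (x : A) :
    ∃ D : A →L[ℂ] A, (∀ b, D b = ∑ i ∈ Finset.range k, x ^ (k - 1 - i) * b * x ^ i) ∧
      HasFDerivAt (fun y => y ^ k) D x := by
  refine ⟨_, fun b => ?_, hasFDerivAt_pow' k⟩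
  simp [mul_assoc]

theorem hasFDerivAt_trace_pow {m : ℕ} (k : ℕ) (M : gl m) :
    ∃ L : gl m →L[ℂ] ℂ, (∀ b, L b = k * Matrix.trace (M ^ (k - 1) * b)) ∧
      HasFDerivAt (fun M : gl m => Matrix.trace (M ^ k)) L M := by
  let T : gl m →L[ℂ] ℂ := LinearMap.toContinuousLinearMap (Matrix.traceLinearMap (Fin m) ℂ ℂ)
  obtain ⟨D, hD, h⟩ : ∃ D : gl m →L[ℂ] gl m,
      (∀ b, D b = ∑ i ∈ Finset.range k, M ^ (k - 1 - i) * b * M ^ i) ∧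
        HasFDerivAt (fun y => y ^ k) D M :=
    open scoped Matrix.Norms.Operator in exists_hasFDerivAt_pow k M
  refine ⟨T.comp D, fun b => ?_, ?_⟩
  · change Matrix.trace (D b) = _
    rw [hD, Matrix.trace_sum, Finset.sum_congr rfl (g := fun _ => Matrix.trace (M ^ (k - 1) * b)),
      Finset.sum_const, Finset.card_range, nsmul_eq_mul]
    intro i hi
    have hi := Finset.mem_range.mp hi
    rw [Matrix.trace_mul_comm, ← mul_assoc, ← pow_add, show i + (k - 1 - i) = k - 1 by omega]
  · open scoped Matrix.Norms.Operator in
    exact HasFDerivAt.comp M (g := T) (f := fun y => y ^ k) T.hasFDerivAt h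

/-- The derivative of the Gelfand-Zeitlin function `tr (B_(m))^i` is `b ↦ i tr ((B_(m))^{i-1} b)`. -/
theorem hasFDerivAt_gzFun {n : ℕ} (q : GZIndex n) (B : gl n) :
    ∃ L : gl n →L[ℂ] ℂ, (∀ b, L b = q.1.2 * Matrix.trace (gzElement q B * b)) ∧
      HasFDerivAt (gzFun q) L B := by
  obtain ⟨L, hL, h⟩ := hasFDerivAt_trace_pow q.1.2 (minor q.2.2.2 B)
  let T : gl n →L[ℂ] gl q.1.1 := LinearMap.toContinuousLinearMap
    { toFun := minor q.2.2.2, map_add' := fun _ _ => rfl, map_smul' := fun _ _ => rfl }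
  open scoped Matrix.Norms.Operator in
  refine ⟨L.comp T, fun b => ?_,
    HasFDerivAt.comp B (f := T) (g := fun M => Matrix.trace (M ^ q.1.2)) h T.hasFDerivAt⟩
  rw [ContinuousLinearMap.comp_apply, hL, gzElement, trace_pad_mul q.2.2.2]
  rfl

theorem differentiableAt_gzFun {n : ℕ} (q : GZIndex n) (B : gl n) :
    DifferentiableAt ℂ (gzFun q) B :=
  (hasFDerivAt_gzFun q B).imp fun _ h => h.2

theorem grad_gzFun {n : ℕ} (q : GZIndex n) (B : gl n) :
    grad (gzFun q) B = (q.1.2 : ℂ) • gzElement q B := by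
  obtain ⟨L, hL, h⟩ := hasFDerivAt_gzFun q B
  apply Matrix.ext_iff_trace_mul_right.mpr
  intro b
  open scoped Matrix.Norms.Operator in
  rw [trace_grad_mul, h.fderiv, hL, Matrix.smul_mul, Matrix.trace_smul, smul_eq_mul]

theorem hasDerivAt_expGL {n : ℕ} (ξ : gl n) (z : ℂ) :
    HasDerivAt (fun w : ℂ => (expGL (w • ξ)).val) (ξ * (expGL (z • ξ)).val) z :=
  open scoped Matrix.Norms.Operator in hasDerivAt_exp_smul_const' (𝕂 := ℂ) ξ z

theorem hasDerivAt_Ad_expGL {n : ℕ} (ξ B : gl n) (z : ℂ) :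
    HasDerivAt (fun w : ℂ => Ad (expGL (w • ξ)) B)
      (ξ * Ad (expGL (z • ξ)) B - Ad (expGL (z • ξ)) B * ξ) z := by
  have hinv : (fun w : ℂ => ((expGL (w • ξ))⁻¹).val) = fun w => (expGL (w • -ξ)).val := by
    funext w
    rw [smul_neg]
    rfl
  have h := hasDerivAt_expGL (-ξ) z
  rw [← hinv, ← congrFun hinv z] at h
  open scoped Matrix.Norms.Operator in
  refine (((hasDerivAt_expGL ξ z).mul_const B).mul h).congr_deriv ?_
  -- The factor `ξ` produced by the inverse has to be moved across `exp (-z ξ)`.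
  have hc : Commute (((expGL (z • ξ))⁻¹).val) ξ :=
    (commute_expGL ((Commute.refl ξ).smul_left z)).units_inv_left
  simp only [Ad]
  rw [neg_mul, ← hc.eq]
  noncomm_ring

theorem hasDerivAt_comp_leftAct_expGL {n : ℕ} (ξ : gl n) (p : CotangentGL n) (z : ℂ)
    {F : CotangentGL n → ℂ} (hF : HolAt F (leftAct (expGL (z • ξ)) p)) :
    HasDerivAt (fun w : ℂ => F (leftAct (expGL (w • ξ)) p))
      (differential F (leftAct (expGL (z • ξ)) p)
        (ξ, ξ * Ad (expGL (z • ξ)) p.2 - Ad (expGL (z • ξ)) p.2 * ξ)) z := by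
  simp_rw [← extend_apply F]
  open scoped Matrix.Norms.Operator in
  have h := (((hasDerivAt_expGL ξ z).mul_const p.1.val).prodMk (hasDerivAt_Ad_expGL ξ p.2 z))
  rw [differential_apply]
  let c (w : ℂ) : gl n × gl n := ((expGL (w • ξ)).val * p.1.val, Ad (expGL (w • ξ)) p.2)
  have hF' : DifferentiableAt ℂ (extend F) (c z) := hF
  exact (HasFDerivAt.comp_hasDerivAt z (f := c) hF'.hasFDerivAt h).congr_deriv
    (by rw [mul_assoc]; rfl)

/-- Hamilton's equations on `T*GL(n, ℂ)`: the generator `i (B_(m))^{i-1}` of the flow is constant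
along the flow and equals the gradient of `tr (B_(m))^i`. -/
theorem hasDerivAt_cotangent {n : ℕ} {Φ : GZGroup n → CotangentGL n → CotangentGL n}
    (hΦ : IsGZActionCotangent Φ) (q : GZIndex n) (p : CotangentGL n) (z : ℂ)
    {F : CotangentGL n → ℂ} (hF : HolAt F (Φ (Pi.single q (q.1.2 * z)) p)) :
    HasDerivAt (fun w : ℂ => F (Φ (Pi.single q (q.1.2 * w)) p))
      (poisson F (fun x => gzFun q (momentLeft x)) (Φ (Pi.single q (q.1.2 * z)) p)) z := by
  have time (w : ℂ) : Φ (Pi.single q (q.1.2 * w)) p =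
      leftAct (expGL (w • (q.1.2 : ℂ) • gzElement q p.2)) p := by
    rw [hΦ.single, mul_comm, mul_smul]
    rfl
  have hgrad : grad (gzFun q) (Φ (Pi.single q (q.1.2 * z)) p).2 =
      (q.1.2 : ℂ) • gzElement q p.2 := by
    rw [grad_gzFun, hΦ.single]
    exact congrArg _ (gzElement_Ad_gzExp_of_le le_rfl _ _)
  rw [poisson_comp_momentLeft F (differentiableAt_gzFun q _), hgrad]
  simp only [time] at hF ⊢
  exact hasDerivAt_comp_leftAct_expGL _ p z hF

/-- Hamilton's equations on `gl(n, ℂ)*`. -/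
theorem hasDerivAt_classical {n : ℕ} {Ψ : GZGroupClassical n → gl n → gl n}
    (hΨ : IsGZActionClassical Ψ) (q : GZIndexClassical n) (B : gl n) (z : ℂ) {f : gl n → ℂ}
    (hf : DifferentiableAt ℂ f (Ψ (Pi.single q (q.1.2 * z)) B)) :
    HasDerivAt (fun w : ℂ => f (Ψ (Pi.single q (q.1.2 * w)) B))
      (liePoisson f (gzFun q.incl) (Ψ (Pi.single q (q.1.2 * z)) B)) z := by
  have time (w : ℂ) : Ψ (Pi.single q (q.1.2 * w)) B =
      Ad (expGL (w • (q.1.2 : ℂ) • gzElement q.incl B)) B := by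
    rw [hΨ.single, mul_comm, mul_smul]
  have hgrad : grad (gzFun q.incl) (Ψ (Pi.single q (q.1.2 * z)) B) =
      (q.1.2 : ℂ) • gzElement q.incl B := by
    rw [grad_gzFun, hΨ.single]
    exact congrArg _ (gzElement_Ad_gzExp_of_le le_rfl _ _)
  rw [liePoisson_eq_fderiv, hgrad]
  simp only [time] at hf ⊢
  open scoped Matrix.Norms.Operator in
  exact HasFDerivAt.comp_hasDerivAt z hf.hasFDerivAt (hasDerivAt_Ad_expGL _ B z)

/-! ### The Poisson quotient by the right action -/

theorem momentLeft_eq_of_rel {n : ℕ} {p q : CotangentGL n} (h : (rightOrbitSetoid n).r p q) :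
    momentLeft p = momentLeft q := by
  obtain ⟨k, rfl⟩ := h
  rfl

/-- The homeomorphism of the orbit space of the right action onto `gl(n, ℂ)` induced by the moment
map of the left action; the inverse is given by the section `B ↦ (1, B)`. -/
noncomputable def quotientHomeomorph (n : ℕ) : RightQuotient n ≃ₜ gl n where
  toFun := Quotient.lift momentLeft fun _ _ => momentLeft_eq_of_rel
  invFun B := toQuotient (1, B)
  left_inv := by
    rintro ⟨p⟩
    exact Quotient.sound ⟨p.1⁻¹, by simp [rightAct, momentLeft]⟩
  right_inv _ := rfl
  continuous_toFun := continuous_snd.quotient_lift _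
  continuous_invFun := continuous_quotient_mk'.comp (Continuous.prodMk_right 1)

/-- The moment map intertwines the action of `A` with the classical action; the flows with `m = n`
become trivial because `B` commutes with its own powers. -/
theorem momentLeft_action {n : ℕ} {Φ : GZGroup n → CotangentGL n → CotangentGL n}
    {Ψ : GZGroupClassical n → gl n → gl n} (hΦ : IsGZActionCotangent Φ)
    (hΨ : IsGZActionClassical Ψ) (a : GZGroup n) (p : CotangentGL n) :
    momentLeft (Φ a p) = Ψ a.restrict (momentLeft p) := by
  refine hΦ.isAction.semiconj hΨ.isAction
    { toFun := GZGroup.restrict, map_zero' := rfl, map_add' := fun _ _ => rfl } momentLeft ?_ a p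
  intro q z p
  rw [hΦ.single]
  change Ad (gzExp q z p.2) p.2 = Ψ (GZGroup.restrict (Pi.single q z)) p.2
  rcases q.2.2.2.lt_or_eq with hq | hq
  · have : GZGroup.restrict (Pi.single q z) =
        Pi.single (⟨q.1, q.2.1, q.2.2.1, hq⟩ : GZIndexClassical n) z :=
      Function.update_comp_eq_of_injective (0 : GZGroup n) GZIndexClassical.incl_injective
        ⟨q.1, q.2.1, q.2.2.1, hq⟩ z
    rw [this, hΨ.single]
    rfl
  · have : GZGroup.restrict (Pi.single q z) = 0 := by
      funext q'
      refine Pi.single_eq_of_ne (M := fun _ => ℂ) (fun h => ?_) z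
      exact q'.2.2.2.ne ((congrArg (fun q : GZIndex n => q.1.1) h).trans hq)
    rw [this, hΨ.isAction.zero, Ad_gzExp_of_eq hq]

theorem action_rightAct {n : ℕ} {Φ : GZGroup n → CotangentGL n → CotangentGL n}
    (hΦ : IsGZActionCotangent Φ) (a : GZGroup n) (h : GL (Fin n) ℂ) (p : CotangentGL n) :
    Φ a (rightAct h p) = rightAct h (Φ a p) := by
  refine (hΦ.isAction.semiconj hΦ.isAction (AddMonoidHom.id _) (rightAct h) ?_ a p).symm
  intro q z p
  rw [AddMonoidHom.id_apply, hΦ.single, hΦ.single, leftAct_rightAct]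
  rfl

end GelfandZeitlin

theorem mainTheorem9 (n : ℕ) :
    -- the action of `A` on `T*GL(n, ℂ)` and the classical action exist and are unique
    (∃! Φ : GZGroup n → CotangentGL n → CotangentGL n,
      IsGZActionCotangent Φ) ∧
    (∃! Ψ : GZGroupClassical n → gl n → gl n,
      IsGZActionClassical Ψ) ∧
    ∀ (Φ : GZGroup n → CotangentGL n → CotangentGL n)
      (Ψ : GZGroupClassical n → gl n → gl n),
      IsGZActionCotangent Φ → IsGZActionClassical Ψ →
      -- Hamilton's equation for `tr (μ_(m))^i` on `T*GL(n, ℂ)`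
      (∀ (q : GZIndex n) (p : CotangentGL n) (z : ℂ)
        (F : CotangentGL n → ℂ),
        HolAt F (Φ (Pi.single q (q.1.2 * z)) p) →
        HasDerivAt (fun w : ℂ => F (Φ (Pi.single q (q.1.2 * w)) p))
          (poisson F
            (fun x => gzFun q (momentLeft x))
            (Φ (Pi.single q (q.1.2 * z)) p)) z) ∧
      -- Hamilton's equation for `tr (B_(m))^i` on `gl(n, ℂ)*`
      (∀ (q : GZIndexClassical n) (B : gl n) (z : ℂ)
        (f : gl n → ℂ),
        DifferentiableAt ℂ f (Ψ (Pi.single q (q.1.2 * z)) B) →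
        HasDerivAt (fun w : ℂ => f (Ψ (Pi.single q (q.1.2 * w)) B))
          (liePoisson f (gzFun q.incl)
            (Ψ (Pi.single q (q.1.2 * z)) B)) z) ∧
      -- the right action preserves the Poisson bracket and commutes with the action of `A`
      (∀ (h : GL (Fin n) ℂ) (F K : CotangentGL n → ℂ)
        (p : CotangentGL n),
        HolAt F (rightAct h p) →
        HolAt K (rightAct h p) →
        poisson (fun x => F (rightAct h x))
            (fun x => K (rightAct h x)) p =
          poisson F K (rightAct h p)) ∧
      (∀ (a : GZGroup n) (h : GL (Fin n) ℂ) (p : CotangentGL n),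
        Φ a (rightAct h p) = rightAct h (Φ a p)) ∧
      -- the moment map identifies the Poisson quotient with `gl(n, ℂ)*`
      ∃ e : RightQuotient n ≃ₜ gl n,
        (∀ p : CotangentGL n,
          e (toQuotient p) = momentLeft p) ∧
        (∀ (f : gl n → ℂ) (p : CotangentGL n),
          HolAt (fun x => f (e (toQuotient x))) p ↔
            DifferentiableAt ℂ f (e (toQuotient p))) ∧
        (∀ (f k : gl n → ℂ) (p : CotangentGL n),
          DifferentiableAt ℂ f (e (toQuotient p)) →
          DifferentiableAt ℂ k (e (toQuotient p)) →
          poisson (fun x => f (e (toQuotient x)))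
              (fun x => k (e (toQuotient x))) p =
            liePoisson f k (e (toQuotient p))) ∧
        -- the action of `A` descends and coincides with the classical action
        ∃ Φ' : GZGroup n → RightQuotient n → RightQuotient n,
          IsAction Φ' ∧
          (∀ (a : GZGroup n) (p : CotangentGL n),
            Φ' a (toQuotient p) = toQuotient (Φ a p)) ∧
          ∀ (a : GZGroup n) (x : RightQuotient n),
            e (Φ' a x) = Ψ a.restrict (e x) := by
  refine ⟨existsUnique_isGZActionCotangent n, existsUnique_isGZActionClassical n, ?_⟩
  intro Φ Ψ hΦ hΨ
  refine ⟨fun q p z F => hasDerivAt_cotangent hΦ q p z,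
    fun q B z f => hasDerivAt_classical hΨ q B z,
    fun h F K p => poisson_comp_rightAct h, action_rightAct hΦ,
    quotientHomeomorph n, fun _ => rfl, holAt_comp_momentLeft_iff,
    fun f k p => poisson_comp_momentLeft_eq_liePoisson, ?_⟩
  refine ⟨fun a => Quotient.map (Φ a) ?_, ⟨?_, ?_⟩, fun _ _ => rfl, ?_⟩
  · rintro p _ ⟨h, rfl⟩
    exact ⟨h, (action_rightAct hΦ a h p).symm⟩
  · rintro ⟨p⟩
    exact congrArg toQuotient (hΦ.isAction.zero p)
  · rintro a b ⟨p⟩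
    exact congrArg toQuotient (hΦ.isAction.add a b p)
  · rintro a ⟨p⟩
    exact momentLeft_action hΦ hΨ a p
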